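/- Let $\mathcal C$ and $\mathcal D$ be rigidly-compactly generated tensor-triangulated categories: triangulated categories with a compatible closed symmetric monoidal structure $(\otimes,\mathbf 1,[-,-])$ that have arbitrary (small) coproducts, that are generated by a set of compact objects, and in which an object $x$ is compact if and only if it is rigid (that is, the canonical map $[x,\mathbf 1]\otimes y\to[x,y]$ is an isomorphism for all $y$). Let $f^*\colon\mathcal D\to\mathcal C$ be a strong symmetric monoidal triangulated functor which preserves arbitrary coproducts. Then $f^*$ has a right adjoint $f_*\colon\mathcal C\to\mathcal D$, which itself has a right adjoint $f^{(1)}\colon\mathcal D\to\mathcal C$. For an object $\kappa$ write $\Delta_\kappa=[-,\kappa]$. An object $x$ is called $\kappa$-reflexive if the canonical morphism $\varpi_\kappa\colon x\to\Delta_\kappa\Delta_\kappa(x)$, the unit of the self-adjunction of $\Delta_\kappa$, is an isomorphism. Let $\mathcal D_0\subseteq\mathcal D$ be a $\mathcal D^c$-submodule, i.e. a thick triangulated subcategory such that $c\otimes x\in\mathcal D_0$ for all $x\in\mathcal D_0$ and all compact $c\in\mathcal D$. Let $\kappa\in\mathcal D_0$ be a dualizing object for $\mathcal D_0$, i.e.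 $\Delta_\kappa$ restricts to an equivalence $\mathcal D_0^{\mathrm{op}}\to\mathcal D_0$. Set $$f^\#(\mathcal D_0)=\{x\in\mathcal C\mid f_*(c\otimes x)\in\mathcal D_0\ \text{for all compact } c\in\mathcal C\}.$$ Then: (a) If $\mathbf 1\in\mathcal D_0$, then every object of $f^\#(\mathcal D_0)$ is $f^{(1)}(\kappa)$-reflexive. (b) If $\mathcal D_0$ consists precisely of the $\kappa$-reflexive objects of $\mathcal D$, then every $f^{(1)}(\kappa)$-reflexive object of $\mathcal C$ belongs to $f^\#(\mathcal D_0)$. -/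

import Mathlib

open CategoryTheory CategoryTheory.Limits CategoryTheory.MonoidalCategory
  CategoryTheory.Pretriangulated Opposite

universe v u u₁ u₂

namespace TensorTriangular

noncomputable section

section ClosedSymmetric

variable {C : Type u} [Category.{v} C] [MonoidalCategory C] [SymmetricCategory C]
  [MonoidalClosed C]

/-- The canonical morphism `[x, 𝟙] ⊗ y ⟶ [x, y]`, adjoint to
`x ⊗ [x, 𝟙] ⊗ y ⟶ 𝟙 ⊗ y ≅ y` (evaluation on the first two factors). -/
def rigidityMap (x y : C) : (ihom x).obj (𝟙_ C) ⊗ y ⟶ (ihom x).obj y :=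
  MonoidalClosed.curry
    ((α_ x ((ihom x).obj (𝟙_ C)) y).inv ≫ (ihom.ev x).app (𝟙_ C) ▷ y ≫ (λ_ y).hom)

/-- An object `x` is rigid (strongly dualizable) if the canonical morphism
`[x, 𝟙] ⊗ y ⟶ [x, y]` is an isomorphism for all `y`. -/
def IsRigid (x : C) : Prop := ∀ y : C, IsIso (rigidityMap x y)

/-- The `κ`-twisted duality functor `Δ_κ = [-, κ]`. -/
def twistedDual (κ : C) : Cᵒᵖ ⥤ C := MonoidalClosed.internalHom.flip.obj κ

/-- The bijection `Hom(x, [y, κ]) ≅ Hom(y ⊗ x, κ) ≅ Hom(x ⊗ y, κ) ≅ Hom(y, [x, κ])`, which makes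
`Δ_κ` adjoint to itself. -/
def selfAdjunctionEquiv (κ x y : C) :
    (x ⟶ (twistedDual κ).obj (op y)) ≃ (y ⟶ (twistedDual κ).obj (op x)) :=
  (((ihom.adjunction y).homEquiv x κ).symm.trans ((β_ y x).homCongr (Iso.refl κ))).trans
    ((ihom.adjunction x).homEquiv y κ)

/-- The canonical morphism `ϖ_κ : x ⟶ Δ_κ Δ_κ x`: the unit of the self-adjunction of `Δ_κ`, that is,
the morphism corresponding to the identity of `Δ_κ x`. -/
def biduality (κ x : C) : x ⟶ (twistedDual κ).obj (op ((twistedDual κ).obj (op x))) :=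
  selfAdjunctionEquiv κ ((twistedDual κ).obj (op x)) x (𝟙 _)

/-- Explicitly, the biduality morphism is adjoint to the evaluation, up to the symmetry. -/
lemma biduality_eq (κ x : C) :
    biduality κ x =
      MonoidalClosed.curry ((β_ ((ihom x).obj κ) x).hom ≫ (ihom.ev x).app κ) := by
  have h : ((ihom.adjunction x).homEquiv ((ihom x).obj κ) κ).symm (𝟙 _) = (ihom.ev x).app κ :=
    MonoidalClosed.uncurry_id_eq_ev x κ
  change (ihom.adjunction ((ihom x).obj κ)).homEquiv x κ
    ((β_ x ((ihom x).obj κ)).inv ≫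
      ((ihom.adjunction x).homEquiv ((ihom x).obj κ) κ).symm (𝟙 _) ≫ 𝟙 κ) = _
  rw [h, Category.comp_id, ← SymmetricCategory.braiding_swap_eq_inv_braiding]
  rfl

/-- An object `x` is `κ`-reflexive if `ϖ_κ : x ⟶ Δ_κ Δ_κ x` is an isomorphism. -/
def IsReflexive (κ x : C) : Prop := IsIso (biduality κ x)

/-- `κ` is an (internal) dualizing object for the full subcategory of `C` given by `P`: it belongs to
`P`, and `Δ_κ` restricts to an equivalence from the opposite of this subcategory to itself. -/
structure IsDualizing (P : ObjectProperty C) (κ : C) : Prop where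
  mem : P κ
  dual_mem : ∀ x : C, P x → P ((twistedDual κ).obj (op x))
  isEquivalence : (P.lift (P.ι.op ⋙ twistedDual κ)
    (fun x => dual_mem x.unop.obj x.unop.property)).IsEquivalence

end ClosedSymmetric

section Compact

variable {C : Type u} [Category.{v} C] [Preadditive C]

/-- An object `t` is compact if `Hom(t, -)`, with values in abelian groups, preserves (small)
coproducts. -/
def IsCompactObject (t : C) : Prop :=
  ∀ J : Type v, PreservesColimitsOfShape (Discrete J) (preadditiveCoyoneda.obj (op t))

variable (C) in
/-- `C` has (small) coproducts and a set of compact objects `g i` such that an object `t` vanishes as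
soon as all groups `Hom(g i, t)` vanish. -/
structure IsCompactlyGenerated : Prop where
  hasCoproducts : HasCoproducts.{v} C
  exists_generators : ∃ (I : Type v) (g : I → C), (∀ i, IsCompactObject (g i)) ∧
    ∀ t : C, (∀ (i : I) (φ : g i ⟶ t), φ = 0) → IsZero t

variable (C) in
/-- `C` is compactly generated, and its compact objects are exactly its rigid objects. -/
structure IsRigidlyCompactlyGenerated [MonoidalCategory C] [SymmetricCategory C]
    [MonoidalClosed C] : Prop extends IsCompactlyGenerated C where
  compact_iff_rigid : ∀ x : C, IsCompactObject x ↔ IsRigid x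

/-- The compact pull-back of `P` along a functor `G : C ⥤ D`: the objects `x` such that `G (c ⊗ x)`
belongs to `P` for all compact `c`. -/
def compactPullback [MonoidalCategory C] {D : Type u₂} [Category.{v} D] (G : C ⥤ D)
    (P : ObjectProperty D) : ObjectProperty C :=
  fun x => ∀ c : C, IsCompactObject c → P (G.obj (c ⊗ x))

end Compact

section Triangulated

variable {C : Type u} [Category.{v} C] [HasZeroObject C] [HasShift C ℤ] [Preadditive C]
  [∀ n : ℤ, (shiftFunctor C n).Additive] [Pretriangulated C] [MonoidalCategory C]

/-- A thick triangulated subcategory of `C` which is stable under tensoring with compact objects. -/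
structure IsCompactSubmodule (P : ObjectProperty C) : Prop where
  isTriangulated : P.IsTriangulated
  isStableUnderRetracts : P.IsStableUnderRetracts
  tensor_mem : ∀ c x : C, IsCompactObject c → P x → P (c ⊗ x)

section

variable [(curriedTensor C).CommShift₂Int]

/-- The structure isomorphism `X⟦n⟧ ⊗ Y ≅ (X ⊗ Y)⟦n⟧`. -/
def shiftTensorIso (X Y : C) (n : ℤ) : X⟦n⟧ ⊗ Y ≅ (X ⊗ Y)⟦n⟧ :=
  (((curriedTensor C).flip.obj Y).commShiftIso n).app X

/-- The structure isomorphism `X ⊗ Y⟦n⟧ ≅ (X ⊗ Y)⟦n⟧`. -/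
def tensorShiftIso (X Y : C) (n : ℤ) : X ⊗ Y⟦n⟧ ≅ (X ⊗ Y)⟦n⟧ :=
  (((curriedTensor C).obj X).commShiftIso n).app Y

/-- The canonical morphism `[X⟦1⟧, W]⟦1⟧ ⟶ [X, W]`, adjoint to
`X ⊗ [X⟦1⟧, W]⟦1⟧ ≅ (X ⊗ [X⟦1⟧, W])⟦1⟧ ≅ X⟦1⟧ ⊗ [X⟦1⟧, W] ⟶ W`. -/
def shiftIhomMap [MonoidalClosed C] (X W : C) :
    ((ihom (X⟦(1 : ℤ)⟧)).obj W)⟦(1 : ℤ)⟧ ⟶ (ihom X).obj W :=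
  MonoidalClosed.curry
    ((tensorShiftIso X ((ihom (X⟦(1 : ℤ)⟧)).obj W) 1).hom ≫
      (shiftTensorIso X ((ihom (X⟦(1 : ℤ)⟧)).obj W) 1).inv ≫
        (ihom.ev (X⟦(1 : ℤ)⟧)).app W)

end

variable (C) in
/-- Compatibility of a closed symmetric monoidal structure with a triangulation.
The instance `(curriedTensor C).CommShift₂Int` provides isomorphisms `X⟦n⟧ ⊗ Y ≅ (X ⊗ Y)⟦n⟧` and
`X ⊗ Y⟦n⟧ ≅ (X ⊗ Y)⟦n⟧`, natural and additive in `n`, such that the two isomorphisms from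
`X⟦m⟧ ⊗ Y⟦n⟧` to the shift of `X ⊗ Y` by `m + n` differ by the sign `(-1) ^ (m * n)`. They are
required to be coherent with the unit, the associativity and the symmetry. Moreover the tensor
product is exact in each variable, and so is the internal hom. For the covariant variable of the
internal hom this is automatic, `[W, -]` being right adjoint to an exact functor; in the contravariant
variable exactness is up to sign, as usual. -/
class IsTensorTriangulated [SymmetricCategory C] [MonoidalClosed C]
    [(curriedTensor C).CommShift₂Int] : Prop where
  unit_compatible : ∀ (X : C) (n : ℤ),
    (shiftTensorIso X (𝟙_ C) n).hom ≫ (ρ_ X).hom⟦n⟧' = (ρ_ (X⟦n⟧)).hom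
  assoc_compatible : ∀ (X Y Z : C) (n : ℤ),
    (shiftTensorIso X Y n).hom ▷ Z ≫ (shiftTensorIso (X ⊗ Y) Z n).hom ≫ (α_ X Y Z).hom⟦n⟧' =
      (α_ (X⟦n⟧) Y Z).hom ≫ (shiftTensorIso X (Y ⊗ Z) n).hom
  symm_compatible : ∀ (X Y : C) (n : ℤ),
    (shiftTensorIso X Y n).hom ≫ (β_ X Y).hom⟦n⟧' =
      (β_ (X⟦n⟧) Y).hom ≫ (tensorShiftIso Y X n).hom
  tensor_exact_left : ∀ X : C, ((curriedTensor C).obj X).IsTriangulated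
  tensor_exact_right : ∀ Y : C, ((curriedTensor C).flip.obj Y).IsTriangulated
  ihom_exact : ∀ (W : C) (T : Triangle C), T ∈ distTriang C →
    ∃ δ : (ihom T.obj₂).obj W ⟶ ((ihom (T.obj₁⟦(1 : ℤ)⟧)).obj W)⟦(1 : ℤ)⟧,
      (δ ≫ shiftIhomMap T.obj₁ W = (MonoidalClosed.pre T.mor₁).app W ∨
        δ ≫ shiftIhomMap T.obj₁ W = -(MonoidalClosed.pre T.mor₁).app W) ∧
      Triangle.mk ((MonoidalClosed.pre T.mor₃).app W) ((MonoidalClosed.pre T.mor₂).app W) δ ∈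
        distTriang C

end Triangulated

end

end TensorTriangular

open TensorTriangular

/-! Write `F = f^*`, `G = f_*`, `H = f^{(1)}`. The core is that `x` is `H κ`-reflexive if and only
if `G (c ⊗ x)` is `κ`-reflexive for every compact `c`. Part (a) follows because objects of `D₀` are
`κ`-reflexive (`IsDualizing.isReflexive`), part (b) because `κ`-reflexive objects lie in `D₀`.

Reflexivity is handled through pairings `p : x ⊗ w ⟶ κ`: right perfect means `w ≅ [x, κ]`, and then
`x` is reflexive exactly when `p` is also left perfect (`isReflexive_iff_leftPerfectAt`). Applying
`G` to a right perfect pairing into `H κ` gives a right perfect pairing into `κ`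
(`rightPerfectAt_pushPairing`); this is Grothendieck duality `G [x, H κ] ≅ [G x, κ]`, and it rests
on the projection formula for rigid objects. By symmetry left perfectness is pushed forward too,
which proves "only if". Conversely, left perfectness after pushing forward, tested at `𝟙_ D`, gives
left perfectness at `𝟙_ C`; twisting by a dual pair `c', c` moves the test object to `c'`, and
compact objects generate.

The adjoints come from Brown representability (`IsCompactlyGenerated.isLeftAdjoint`), used twice:
`G` preserves coproducts because `F` preserves rigid, hence compact, objects. -/

namespace TensorTriangular

/-! ### Compact objects and coproducts -/

section Preadditive

variable {C : Type u} [Category.{v} C] [Preadditive C]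

/-- The quotient of `Hom(k, ∐ X)` by the subgroup generated by morphisms through one summand
receives zero from every `Hom(k, X j)`. Since `Hom(k, -)` preserves the coproduct, the quotient map
is zero. -/
lemma exists_finset_sum_of_isCompactObject {k : C} (hk : IsCompactObject k) {J : Type v}
    (X : J → C) [HasCoproduct X] (φ : k ⟶ ∐ X) :
    ∃ (s : Finset J) (f : ∀ j, k ⟶ X j), φ = ∑ j ∈ s, f j ≫ Sigma.ι X j := by
  classical
  have := hk J
  let K : AddSubgroup (k ⟶ ∐ X) :=
    ⨆ j, (AddMonoidHom.range (Preadditive.rightComp k (Sigma.ι X j)))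
  have hK : K = ⊤ := by
    let G := preadditiveCoyoneda.obj (op k)
    let q : G.obj (∐ X) ⟶ AddCommGrpCat.of ((k ⟶ ∐ X) ⧸ K) :=
      AddCommGrpCat.ofHom (QuotientAddGroup.mk' K)
    have hq : q = 0 := by
      refine (isColimitOfPreserves G (coproductIsCoproduct X)).hom_ext ?_
      rintro ⟨j⟩
      ext f
      have : f ≫ Sigma.ι X j ∈ K :=
        (le_iSup (fun j => AddMonoidHom.range (Preadditive.rightComp k (Sigma.ι X j))) j) ⟨f, rfl⟩
      exact (QuotientAddGroup.eq_zero_iff _).2 this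
    rw [eq_top_iff]
    intro f _
    have := ConcreteCategory.congr_hom hq f
    exact (QuotientAddGroup.eq_zero_iff _).1 this
  have hφ : φ ∈ K := hK ▸ AddSubgroup.mem_top φ
  induction hφ using AddSubgroup.iSup_induction' with
  | hp j x hx =>
    obtain ⟨f, rfl⟩ := hx
    exact ⟨{j}, Function.update 0 j f, by simp [Preadditive.rightComp]⟩
  | h1 => exact ⟨∅, fun _ => 0, by simp⟩
  | hadd x y _ _ hx hy =>
    obtain ⟨s, f, rfl⟩ := hx
    obtain ⟨t, g, rfl⟩ := hy
    refine ⟨s ∪ t, fun j => (if j ∈ s then f j else 0) + (if j ∈ t then g j else 0), ?_⟩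
    simp only [Preadditive.add_comp, Finset.sum_add_distrib]
    congr 1
    · rw [← Finset.sum_subset (Finset.subset_union_left (s₂ := t))]
      · exact Finset.sum_congr rfl (fun j hj => by simp [hj])
      · intro j _ hj; simp [hj]
    · rw [← Finset.sum_subset (Finset.subset_union_right (s₁ := s))]
      · exact Finset.sum_congr rfl (fun j hj => by simp [hj])
      · intro j _ hj; simp [hj]

lemma exists_eq_sum_comp_π_comp_ι {k : C} (hk : IsCompactObject k) {J : Type v}
    [DecidableEq J] (X : J → C) [HasCoproduct X] (φ : k ⟶ ∐ X) :
    ∃ s : Finset J, φ = ∑ j ∈ s, (φ ≫ Sigma.π X j) ≫ Sigma.ι X j := by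
  obtain ⟨s, f, rfl⟩ := exists_finset_sum_of_isCompactObject hk X φ
  refine ⟨s, Finset.sum_congr rfl (fun j hj => ?_)⟩
  congr 1
  rw [Preadditive.sum_comp, Finset.sum_eq_single j]
  · simp
  · intro i _ hij
    rw [Category.assoc, Sigma.ι_π_of_ne X hij, comp_zero]
  · exact fun h => (h hj).elim

lemma eq_zero_of_comp_π_eq_zero {k : C} (hk : IsCompactObject k) {J : Type v}
    [DecidableEq J] (X : J → C) [HasCoproduct X] (φ : k ⟶ ∐ X)
    (h : ∀ j, φ ≫ Sigma.π X j = 0) : φ = 0 := by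
  obtain ⟨s, hs⟩ := exists_eq_sum_comp_π_comp_ι hk X φ
  rw [hs]
  exact Finset.sum_eq_zero (fun j _ => by rw [h, zero_comp])

/-- The natural isomorphism `Hom(k, G -) ≅ Hom(F k, -)` of functors to abelian groups attached to
an additive adjunction `F ⊣ G`. -/
def compPreadditiveCoyonedaIso {D : Type u₂} [Category.{v} D] [Preadditive D] {F : C ⥤ D}
    {G : D ⥤ C} (adj : F ⊣ G) [F.Additive] (k : C) :
    G ⋙ preadditiveCoyoneda.obj (op k) ≅ preadditiveCoyoneda.obj (op (F.obj k)) :=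
  NatIso.ofComponents (fun X => (adj.homAddEquiv k X).symm.toAddCommGrpIso) (fun f => by
    ext φ
    exact adj.homEquiv_naturality_right_symm φ f)

lemma isCompactObject_obj_of_adjunction {D : Type u₂} [Category.{v} D] [Preadditive D] {F : C ⥤ D}
    {G : D ⥤ C} (adj : F ⊣ G) [F.Additive]
    (hG : ∀ J : Type v, PreservesColimitsOfShape (Discrete J) G) {k : C} (hk : IsCompactObject k) :
    IsCompactObject (F.obj k) := fun J =>
  have := hk J
  have := hG J
  preservesColimitsOfShape_of_natIso (compPreadditiveCoyonedaIso adj k)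

lemma isCompactObject_shift [HasShift C ℤ] [∀ n : ℤ, (shiftFunctor C n).Additive] {k : C}
    (hk : IsCompactObject k) (n : ℤ) : IsCompactObject (k⟦n⟧) :=
  have adj : shiftFunctor C n ⊣ shiftFunctor C (-n) := (shiftEquiv C n).toAdjunction
  isCompactObject_obj_of_adjunction adj (fun _ => inferInstance) hk

/-- A family of compact objects, stable under desuspension, which detects zero objects. -/
structure IsCompactGeneratingFamily [HasShift C ℤ] {I : Type v} (g : I → C) : Prop where
  isCompactObject : ∀ i, IsCompactObject (g i)
  exists_iso_shift : ∀ i, ∃ j, Nonempty ((g i)⟦(-1 : ℤ)⟧ ≅ g j)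
  isZero : ∀ t : C, (∀ (i : I) (φ : g i ⟶ t), φ = 0) → IsZero t

lemma IsCompactlyGenerated.exists_isCompactGeneratingFamily [HasShift C ℤ]
    [∀ n : ℤ, (shiftFunctor C n).Additive] (hC : IsCompactlyGenerated C) :
    ∃ (I : Type v) (g : I → C), IsCompactGeneratingFamily g := by
  obtain ⟨I, g, hg, hg'⟩ := hC.exists_generators
  refine ⟨I × ℤ, fun p => (g p.1)⟦p.2⟧, fun p => isCompactObject_shift (hg _) _,
    fun p => ⟨(p.1, p.2 - 1), ⟨((shiftFunctorAdd' C p.2 (-1) (p.2 - 1) (by lia)).app _).symm⟩⟩,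
    fun t ht => hg' t (fun i φ => ?_)⟩
  have := ht (i, 0) ((shiftFunctorZero C ℤ).hom.app _ ≫ φ)
  rwa [Preadditive.IsIso.comp_left_eq_zero] at this

end Preadditive

/-! ### Detecting isomorphisms on compact generators -/

section Pretriangulated

variable {C : Type u} [Category.{v} C] [HasZeroObject C] [HasShift C ℤ] [Preadditive C]
  [∀ n : ℤ, (shiftFunctor C n).Additive] [Pretriangulated C] {I : Type v} {g : I → C}

namespace IsCompactGeneratingFamily

variable (hg : IsCompactGeneratingFamily g)
include hg

/-- Morphisms out of the generators detect isomorphisms. -/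
lemma isIso {X Y : C} (u : X ⟶ Y) (h : ∀ i, Function.Bijective (fun φ : g i ⟶ X => φ ≫ u)) :
    IsIso u := by
  obtain ⟨Z, v, w, hT⟩ := distinguished_cocone_triangle u
  have hZ : ∀ {k : C} (φ : k ⟶ Z), φ ≫ w = 0 → ∃ ψ : k ⟶ Y, φ = ψ ≫ v :=
    fun φ => Triangle.coyoneda_exact₃ _ hT φ
  have huv : u ≫ v = 0 := comp_distTriang_mor_zero₁₂ _ hT
  refine (Triangle.isZero₃_iff_isIso₁ _ hT).1 (hg.isZero Z (fun i φ => ?_))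
  have hw : w ≫ u⟦1⟧' = 0 := comp_distTriang_mor_zero₃₁ _ hT
  -- Desuspending turns `φ ≫ w` into a morphism to `X` killed by `u`; its source is again a
  -- generator `g j`, so injectivity at `j` applies.
  have hφ : φ ≫ w = 0 := by
    obtain ⟨j, ⟨e⟩⟩ := hg.exists_iso_shift i
    let a : (g i)⟦(-1 : ℤ)⟧ ⟶ X := (φ ≫ w)⟦(-1 : ℤ)⟧' ≫
      (shiftFunctorCompIsoId C (1 : ℤ) (-1) (by lia)).hom.app X
    have ha : a ≫ u = 0 := by
      have := (shiftFunctorCompIsoId C (1 : ℤ) (-1) (by lia)).hom.naturality u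
      dsimp at this
      rw [Category.assoc, ← this, ← Functor.map_comp_assoc, Category.assoc, hw]
      simp
    have ha' : a = 0 := by
      rw [← cancel_epi e.inv, comp_zero]
      apply (h j).1
      simp [ha]
    rw [← (shiftFunctor C (-1 : ℤ)).map_eq_zero_iff]
    rwa [Preadditive.IsIso.comp_right_eq_zero] at ha'
  obtain ⟨ψ, rfl⟩ := hZ φ hφ
  obtain ⟨χ, rfl⟩ := (h i).2 ψ
  rw [Category.assoc, huv, comp_zero]

end IsCompactGeneratingFamily

end Pretriangulated

end TensorTriangular

namespace TensorTriangular

/-! ### Brown representability, by homotopy colimits over the comma category -/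

section Brown

variable {C : Type u₁} [Category.{v} C] {D : Type u₂} [Category.{v} D]

section Coproducts

variable (F : C ⥤ D) {J : Type v} (X : J → C) [HasCoproduct X]
  [PreservesColimitsOfShape (Discrete J) F] {c : D}

lemma map_sigma_hom_ext {a b : F.obj (∐ X) ⟶ c}
    (h : ∀ j, F.map (Sigma.ι X j) ≫ a = F.map (Sigma.ι X j) ≫ b) : a = b :=
  (isColimitOfPreserves F (coproductIsCoproduct X)).hom_ext (fun ⟨j⟩ => h j)

lemma exists_map_sigma_desc (a : ∀ j, F.obj (X j) ⟶ c) :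
    ∃ b : F.obj (∐ X) ⟶ c, ∀ j, F.map (Sigma.ι X j) ≫ b = a j :=
  ⟨(isColimitOfPreserves F (coproductIsCoproduct X)).desc (Cocone.mk c
    (Discrete.natTrans (fun ⟨j⟩ => a j))), fun j =>
    (isColimitOfPreserves F (coproductIsCoproduct X)).fac (Cocone.mk c
      (Discrete.natTrans (fun ⟨j⟩ => a j))) ⟨j⟩⟩

end Coproducts

variable [HasZeroObject C] [HasShift C ℤ] [Preadditive C]
  [∀ n : ℤ, (shiftFunctor C n).Additive] [Pretriangulated C]
  [HasZeroObject D] [HasShift D ℤ] [Preadditive D]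
  [∀ n : ℤ, (shiftFunctor D n).Additive] [Pretriangulated D]
  (F : C ⥤ D) [F.CommShift ℤ] [F.IsTriangulated] {c : D}

lemma exists_map_comp_eq_of_distTriang {X Y Z : C} {a : X ⟶ Y} {b : Y ⟶ Z} {d : Z ⟶ X⟦(1 : ℤ)⟧}
    (hT : Triangle.mk a b d ∈ distTriang C) (ξ : F.obj Y ⟶ c) (h : F.map a ≫ ξ = 0) :
    ∃ ζ : F.obj Z ⟶ c, F.map b ≫ ζ = ξ := by
  obtain ⟨ζ, hζ⟩ := Triangle.yoneda_exact₂ _ (F.map_distinguished _ hT) ξ h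
  exact ⟨ζ, hζ.symm⟩

section Telescope

variable [HasCoproducts.{v} C] {k : C}

/-- The endomorphism `1 - shift` of the coproduct of a sequence, whose cone is the homotopy
colimit of the sequence. -/
noncomputable def telescopeMap {X : ℕ → C} (f : ∀ n, X n ⟶ X (n + 1)) :
    (∐ fun n : ULift.{v} ℕ => X n.down) ⟶ ∐ fun n : ULift.{v} ℕ => X n.down :=
  𝟙 _ - Limits.Sigma.desc (fun n : ULift.{v} ℕ => f n.down ≫ Sigma.ι (fun n : ULift.{v} ℕ => X n.down) ⟨n.down + 1⟩)

omit [HasZeroObject C] [HasShift C ℤ] [∀ n : ℤ, (shiftFunctor C n).Additive]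
  [Pretriangulated C] in
lemma ι_telescopeMap {X : ℕ → C} (f : ∀ n, X n ⟶ X (n + 1)) (n : ℕ) :
    Sigma.ι (fun n : ULift.{v} ℕ => X n.down) ⟨n⟩ ≫ telescopeMap f =
      Sigma.ι (fun n : ULift.{v} ℕ => X n.down) ⟨n⟩ -
        f n ≫ Sigma.ι (fun n : ULift.{v} ℕ => X n.down) ⟨n + 1⟩ := by
  simp [telescopeMap, Preadditive.comp_sub]

omit [HasZeroObject C] [HasShift C ℤ] [∀ n : ℤ, (shiftFunctor C n).Additive]
  [Pretriangulated C] in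
-- The hypothesis forces the component of `φ` at `0` to vanish and its component at `m + 1` to be
-- the one at `m` followed by `f m`. All components vanish by induction, and they detect zero since
-- `k` is compact.
lemma eq_zero_of_comp_telescopeMap_eq_zero (hk : IsCompactObject k) {X : ℕ → C}
    (f : ∀ n, X n ⟶ X (n + 1)) (φ : k ⟶ ∐ fun n : ULift.{v} ℕ => X n.down)
    (h : φ ≫ telescopeMap f = 0) : φ = 0 := by
  let Y := fun n : ULift.{v} ℕ => X n.down
  have h₀ : telescopeMap f ≫ Sigma.π Y ⟨0⟩ = Sigma.π Y ⟨0⟩ := by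
    refine Sigma.hom_ext _ _ (fun ⟨n⟩ => ?_)
    rw [← Category.assoc, ι_telescopeMap, Preadditive.sub_comp, Category.assoc,
      Sigma.ι_π_of_ne Y (b := ⟨n + 1⟩) (c := ⟨0⟩) (by simp), comp_zero, sub_zero]
  have h₁ (m : ℕ) : telescopeMap f ≫ Sigma.π Y ⟨m + 1⟩ =
      Sigma.π Y ⟨m + 1⟩ - Sigma.π Y ⟨m⟩ ≫ f m := by
    refine Sigma.hom_ext _ _ (fun ⟨n⟩ => ?_)
    rw [← Category.assoc, ι_telescopeMap, Preadditive.sub_comp, Preadditive.comp_sub,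
      Category.assoc]
    congr 1
    by_cases hnm : n = m
    · subst hnm
      rw [Sigma.ι_π_eq_id Y ⟨n + 1⟩, ← Category.assoc, Sigma.ι_π_eq_id Y ⟨n⟩]
      simp [Y]
    · rw [Sigma.ι_π_of_ne Y (b := ⟨n + 1⟩) (c := ⟨m + 1⟩) (by simpa using hnm), ← Category.assoc,
        Sigma.ι_π_of_ne Y (b := ⟨n⟩) (c := ⟨m⟩) (by simpa using hnm), comp_zero, zero_comp]
  refine eq_zero_of_comp_π_eq_zero hk Y φ (fun ⟨n⟩ => ?_)
  induction n with
  | zero => simpa [h₀] using h =≫ Sigma.π Y ⟨0⟩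
  | succ n hn =>
    have := h =≫ Sigma.π Y ⟨n + 1⟩
    rw [Category.assoc, h₁, Preadditive.comp_sub, ← Category.assoc φ (Sigma.π Y ⟨n⟩), zero_comp,
      sub_eq_zero] at this
    exact this.trans (by rw [hn, zero_comp])

/-- Morphisms from a compact object to a homotopy colimit factor through a finite stage. -/
lemma exists_factorization_of_isCompactObject (hk : IsCompactObject (k⟦(-1 : ℤ)⟧))
    (hk' : IsCompactObject k) {X : ℕ → C} (f : ∀ n, X n ⟶ X (n + 1)) {Z : C}
    {q : (∐ fun n : ULift.{v} ℕ => X n.down) ⟶ Z}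
    {d : Z ⟶ (∐ fun n : ULift.{v} ℕ => X n.down)⟦(1 : ℤ)⟧}
    (hT : Triangle.mk (telescopeMap f) q d ∈ distTriang C) (φ : k ⟶ Z) :
    ∃ (n : ℕ) (ψ : k ⟶ X n), φ = ψ ≫ Sigma.ι (fun n : ULift.{v} ℕ => X n.down) ⟨n⟩ ≫ q := by
  let Y := fun n : ULift.{v} ℕ => X n.down
  have hq : telescopeMap f ≫ q = 0 := comp_distTriang_mor_zero₁₂ _ hT
  have hd : d ≫ (telescopeMap f)⟦(1 : ℤ)⟧' = 0 := comp_distTriang_mor_zero₃₁ _ hT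
  have hZ : ∀ φ : k ⟶ Z, φ ≫ d = 0 → ∃ ψ : k ⟶ ∐ Y, φ = ψ ≫ q :=
    fun φ => Triangle.coyoneda_exact₃ _ hT φ
  have hφ : φ ≫ d = 0 := by
    let a : k⟦(-1 : ℤ)⟧ ⟶ ∐ Y := (φ ≫ d)⟦(-1 : ℤ)⟧' ≫
      (shiftFunctorCompIsoId C (1 : ℤ) (-1) (by lia)).hom.app (∐ Y)
    have ha : a = 0 := by
      refine eq_zero_of_comp_telescopeMap_eq_zero hk f a ?_
      have := (shiftFunctorCompIsoId C (1 : ℤ) (-1) (by lia)).hom.naturality (telescopeMap f)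
      dsimp at this
      rw [Category.assoc, ← this, ← Functor.map_comp_assoc, Category.assoc, hd]
      simp
    rw [← (shiftFunctor C (-1 : ℤ)).map_eq_zero_iff]
    rwa [Preadditive.IsIso.comp_right_eq_zero] at ha
  obtain ⟨ψ, rfl⟩ := hZ φ hφ
  have hstep (n : ℕ) : Sigma.ι Y ⟨n⟩ ≫ q = f n ≫ Sigma.ι Y ⟨n + 1⟩ ≫ q := by
    have := ι_telescopeMap f n =≫ q
    rwa [Category.assoc, hq, comp_zero, Preadditive.sub_comp, Category.assoc, eq_comm,
      sub_eq_zero] at this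
  have hle (n m : ℕ) : ∃ t : X n ⟶ X (n + m), Sigma.ι Y ⟨n⟩ ≫ q = t ≫ Sigma.ι Y ⟨n + m⟩ ≫ q := by
    induction m with
    | zero => exact ⟨𝟙 _, by simp⟩
    | succ m hm =>
      obtain ⟨t, ht⟩ := hm
      exact ⟨t ≫ f (n + m), by rw [ht, hstep, Category.assoc]; rfl⟩
  have hle' {n m : ℕ} (h : n ≤ m) :
      ∃ t : X n ⟶ X m, Sigma.ι Y ⟨n⟩ ≫ q = t ≫ Sigma.ι Y ⟨m⟩ ≫ q := by
    obtain ⟨m, rfl⟩ := Nat.exists_eq_add_of_le h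
    exact hle n m
  -- Over the homotopy colimit, a finite sum of morphisms through various stages moves to the
  -- largest stage involved.
  have key (χ : ∀ j, k ⟶ Y j) (s : Finset (ULift.{v} ℕ)) :
      ∃ (n : ℕ) (α : k ⟶ X n), (∑ j ∈ s, χ j ≫ Sigma.ι Y j) ≫ q = α ≫ Sigma.ι Y ⟨n⟩ ≫ q := by
    induction s using Finset.induction_on with
    | empty => exact ⟨0, 0, by simp⟩
    | insert j s hj ih =>
      obtain ⟨n, α, hα⟩ := ih
      obtain ⟨t, ht⟩ := hle' (le_max_left n j.down)
      obtain ⟨t', ht'⟩ := hle' (le_max_right n j.down)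
      refine ⟨max n j.down, α ≫ t + χ j ≫ t', ?_⟩
      rw [Finset.sum_insert hj, Preadditive.add_comp, hα, add_comm, Preadditive.add_comp, ht,
        Category.assoc, Category.assoc, Category.assoc, ← ht']
  obtain ⟨s, hs⟩ := exists_eq_sum_comp_π_comp_ι hk' Y ψ
  obtain ⟨n, α, hα⟩ := key (fun j => ψ ≫ Sigma.π Y j) s
  exact ⟨n, α, by rw [hs, hα]⟩

end Telescope

section Representability

open ZeroObject

variable {I : Type v} {g : I → C}

/-- An object over `c` is universal for the family `g` if it represents `Hom(F -, c)` on the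
members of the family. -/
structure IsUniversalOn (g : I → C) (B : CostructuredArrow F c) : Prop where
  eq_zero : ∀ (i : I) (φ : g i ⟶ B.left), F.map φ ≫ B.hom = 0 → φ = 0
  exists_lift : ∀ (i : I) (α : F.obj (g i) ⟶ c), ∃ φ : g i ⟶ B.left, F.map φ ≫ B.hom = α

variable [HasCoproducts.{v} C] [∀ J : Type v, PreservesColimitsOfShape (Discrete J) F]

/-- Take the cone of the coproduct of all the morphisms to be killed; the structure map extends over
it because `Hom(F -, c)` is cohomological and turns coproducts into products. -/
lemma exists_hom_killing (g : I → C) (A : CostructuredArrow F c) :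
    ∃ (B : CostructuredArrow F c) (u : A ⟶ B),
      ∀ (i : I) (φ : g i ⟶ A.left), F.map φ ≫ A.hom = 0 → φ ≫ u.left = 0 := by
  let J := Σ i, { φ : g i ⟶ A.left // F.map φ ≫ A.hom = 0 }
  let Y : J → C := fun j => g j.1
  let p : ∐ Y ⟶ A.left := Limits.Sigma.desc (fun j : J => j.2.1)
  have hp : F.map p ≫ A.hom = 0 := map_sigma_hom_ext F Y (fun j => by
    rw [← Category.assoc, ← F.map_comp, Sigma.ι_desc, j.2.2, comp_zero])
  obtain ⟨Z, a, d, hT⟩ := distinguished_cocone_triangle p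
  obtain ⟨ζ, hζ⟩ := exists_map_comp_eq_of_distTriang F hT A.hom hp
  have hpa : p ≫ a = 0 := comp_distTriang_mor_zero₁₂ _ hT
  refine ⟨CostructuredArrow.mk ζ, CostructuredArrow.homMk a hζ, fun i φ hφ => ?_⟩
  have : Sigma.ι Y ⟨i, φ, hφ⟩ ≫ p = φ := Sigma.ι_desc _ _
  change φ ≫ a = 0
  rw [← this, Category.assoc, hpa, comp_zero]

/-- In the homotopy colimit, a morphism from a generator factors through some `A n`; if it dies in
`c`, then the next transition map already kills it. -/
lemma exists_hom_of_sequence (hg : IsCompactGeneratingFamily g) (A : ℕ → CostructuredArrow F c)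
    (u : ∀ n, A n ⟶ A (n + 1))
    (hu : ∀ n (i : I) (φ : g i ⟶ (A n).left), F.map φ ≫ (A n).hom = 0 → φ ≫ (u n).left = 0) :
    ∃ (B : CostructuredArrow F c) (_ : A 0 ⟶ B),
      ∀ (i : I) (φ : g i ⟶ B.left), F.map φ ≫ B.hom = 0 → φ = 0 := by
  let f : ∀ n, (A n).left ⟶ (A (n + 1)).left := fun n => (u n).left
  let Y := fun n : ULift.{v} ℕ => (A n.down).left
  obtain ⟨Z, q, d, hT⟩ := distinguished_cocone_triangle (telescopeMap f)
  obtain ⟨ζ, hζ⟩ := exists_map_sigma_desc F Y (fun n => (A n.down).hom)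
  have hζ' : F.map (telescopeMap f) ≫ ζ = 0 := map_sigma_hom_ext F Y (fun ⟨n⟩ => by
    have h : Sigma.ι Y ⟨n⟩ ≫ telescopeMap f = Sigma.ι Y ⟨n⟩ - f n ≫ Sigma.ι Y ⟨n + 1⟩ :=
      ι_telescopeMap f n
    rw [← Category.assoc, ← F.map_comp, h, F.map_sub, Preadditive.sub_comp,
      F.map_comp, Category.assoc, hζ, hζ, CostructuredArrow.w (u n), comp_zero, sub_self])
  obtain ⟨ξ, hξ⟩ := exists_map_comp_eq_of_distTriang F hT ζ hζ'
  have hq : telescopeMap f ≫ q = 0 := comp_distTriang_mor_zero₁₂ _ hT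
  have hξ' (n : ℕ) : F.map (Sigma.ι Y ⟨n⟩ ≫ q) ≫ ξ = (A n).hom := by
    rw [F.map_comp, Category.assoc, hξ, hζ]
  refine ⟨CostructuredArrow.mk ξ, CostructuredArrow.homMk (Sigma.ι Y ⟨0⟩ ≫ q) (hξ' 0),
    fun i (φ : g i ⟶ Z) (hφ : F.map φ ≫ ξ = 0) => ?_⟩
  obtain ⟨n, ψ, rfl⟩ := exists_factorization_of_isCompactObject
    (isCompactObject_shift (hg.isCompactObject i) (-1)) (hg.isCompactObject i) f hT φ
  rw [F.map_comp, Category.assoc, hξ' n] at hφ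
  have hstep : Sigma.ι Y ⟨n⟩ ≫ q = f n ≫ Sigma.ι Y ⟨n + 1⟩ ≫ q := by
    have := ι_telescopeMap f n =≫ q
    rwa [Category.assoc, hq, comp_zero, Preadditive.sub_comp, Category.assoc, eq_comm,
      sub_eq_zero] at this
  rw [hstep, ← Category.assoc, hu n i ψ hφ, zero_comp]

/-- Adding one copy of `g i` for each `F.obj (g i) ⟶ c` gives surjectivity, which persists along the
sequence; iterating `exists_hom_killing` gives injectivity in the limit. -/
lemma exists_hom_isUniversalOn (hg : IsCompactGeneratingFamily g) (A : CostructuredArrow F c) :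
    ∃ (B : CostructuredArrow F c) (_ : A ⟶ B), IsUniversalOn F g B := by
  let J := Σ i, (F.obj (g i) ⟶ c)
  let Y : J → C := fun j => g j.1
  obtain ⟨ζ, hζ⟩ := exists_map_sigma_desc F Y (fun j => j.2)
  let A₀ : CostructuredArrow F c :=
    CostructuredArrow.mk (F.map (biprod.fst : A.left ⊞ ∐ Y ⟶ _) ≫ A.hom + F.map biprod.snd ≫ ζ)
  let v : A ⟶ A₀ := CostructuredArrow.homMk biprod.inl (by
    change F.map biprod.inl ≫ (F.map biprod.fst ≫ A.hom + F.map biprod.snd ≫ ζ) = A.hom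
    rw [Preadditive.comp_add, ← F.map_comp_assoc, ← F.map_comp_assoc]
    simp)
  choose next u hu using exists_hom_killing F g (c := c)
  let S : ℕ → CostructuredArrow F c := fun n => Nat.rec A₀ (fun _ B => next B) n
  obtain ⟨B, w, hB⟩ := exists_hom_of_sequence F hg S (fun n => u (S n)) (fun n => hu (S n))
  refine ⟨B, v ≫ w, hB, fun i α => ⟨Sigma.ι Y ⟨i, α⟩ ≫ biprod.inr ≫ w.left, ?_⟩⟩
  have hw : F.map w.left ≫ B.hom = F.map biprod.fst ≫ A.hom + F.map biprod.snd ≫ ζ :=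
    CostructuredArrow.w w
  rw [F.map_comp, F.map_comp, Category.assoc, Category.assoc, hw, Preadditive.comp_add,
    ← F.map_comp_assoc, ← F.map_comp_assoc]
  simp [hζ]

omit [HasCoproducts.{v} C] [∀ J : Type v, PreservesColimitsOfShape (Discrete J) F] in
lemma IsUniversalOn.isIso (hg : IsCompactGeneratingFamily g) {B B' : CostructuredArrow F c}
    (hB : IsUniversalOn F g B) (hB' : IsUniversalOn F g B') (u : B ⟶ B') : IsIso u := by
  have hu := CostructuredArrow.w u
  have : IsIso u.left := hg.isIso u.left (fun i => by
    constructor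
    · intro φ φ' h
      rw [← sub_eq_zero]
      refine hB.eq_zero i _ ?_
      have h' : (φ - φ') ≫ u.left = 0 := by
        rw [Preadditive.sub_comp, sub_eq_zero]; exact h
      rw [← hu, ← F.map_comp_assoc, h', F.map_zero, zero_comp]
    · intro φ'
      obtain ⟨φ, hφ⟩ := hB.exists_lift i (F.map φ' ≫ B'.hom)
      refine ⟨φ, ?_⟩
      change φ ≫ u.left = φ'
      rw [← sub_eq_zero]
      refine hB'.eq_zero i _ ?_
      rw [F.map_sub, Preadditive.sub_comp, F.map_comp, Category.assoc, hu, hφ, sub_self])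
  have : IsIso ((CostructuredArrow.proj F c).map u) := this
  exact isIso_of_reflects_iso u (CostructuredArrow.proj F c)

/-- The structure map of `B` extends to the cone of `a - b`. Mapping that cone to a universal object
makes the composite from `B` an isomorphism, yet it annihilates `a - b`. -/
lemma IsUniversalOn.hom_ext (hg : IsCompactGeneratingFamily g) {A B : CostructuredArrow F c}
    (hB : IsUniversalOn F g B) (a b : A ⟶ B) : a = b := by
  have hab : F.map (a.left - b.left) ≫ B.hom = 0 := by
    rw [F.map_sub, Preadditive.sub_comp, CostructuredArrow.w a, CostructuredArrow.w b, sub_self]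
  obtain ⟨Z, q, d, hT⟩ := distinguished_cocone_triangle (a.left - b.left)
  obtain ⟨ζ, hζ⟩ := exists_map_comp_eq_of_distTriang F hT B.hom hab
  have hq : (a.left - b.left) ≫ q = 0 := comp_distTriang_mor_zero₁₂ _ hT
  let w : B ⟶ CostructuredArrow.mk ζ := CostructuredArrow.homMk q hζ
  obtain ⟨B', v, hB'⟩ := exists_hom_isUniversalOn F hg (CostructuredArrow.mk ζ)
  have : IsIso (w ≫ v) := IsUniversalOn.isIso F hg hB hB' _
  have : IsIso (w ≫ v).left := inferInstanceAs (IsIso ((CostructuredArrow.proj F c).map (w ≫ v)))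
  ext
  rw [← cancel_mono (w ≫ v).left, ← sub_eq_zero, ← Preadditive.sub_comp]
  change _ ≫ q ≫ v.left = 0
  rw [← Category.assoc, hq, zero_comp]

omit [HasCoproducts.{v} C] in
/-- Brown representability: a coproduct-preserving triangulated functor out of a
compactly generated triangulated category has a right adjoint. -/
theorem IsCompactlyGenerated.isLeftAdjoint (hC : IsCompactlyGenerated C) (F : C ⥤ D)
    [F.CommShift ℤ] [F.IsTriangulated]
    (hF : ∀ J : Type v, PreservesColimitsOfShape (Discrete J) F) : F.IsLeftAdjoint := by
  have := hC.hasCoproducts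
  obtain ⟨I, g, hg⟩ := hC.exists_isCompactGeneratingFamily
  rw [isLeftAdjoint_iff_hasTerminal_costructuredArrow]
  intro c
  obtain ⟨B, -, hB⟩ := exists_hom_isUniversalOn F hg (CostructuredArrow.mk (0 : F.obj 0 ⟶ c))
  -- Embed `A` and `B` in their sum and map it to a universal `B'`; then `B ⟶ B'` is invertible and
  -- `A ⟶ B'` can be brought back to `B`.
  have hlift (A : CostructuredArrow F c) : Nonempty (A ⟶ B) := by
    let P : CostructuredArrow F c := CostructuredArrow.mk
      (F.map (biprod.fst : A.left ⊞ B.left ⟶ _) ≫ A.hom + F.map biprod.snd ≫ B.hom)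
    let a : A ⟶ P := CostructuredArrow.homMk biprod.inl (by
      change F.map biprod.inl ≫ (F.map biprod.fst ≫ A.hom + F.map biprod.snd ≫ B.hom) = _
      rw [Preadditive.comp_add, ← F.map_comp_assoc, ← F.map_comp_assoc]
      simp)
    let b : B ⟶ P := CostructuredArrow.homMk biprod.inr (by
      change F.map biprod.inr ≫ (F.map biprod.fst ≫ A.hom + F.map biprod.snd ≫ B.hom) = _
      rw [Preadditive.comp_add, ← F.map_comp_assoc, ← F.map_comp_assoc]
      simp)
    obtain ⟨B', v, hB'⟩ := exists_hom_isUniversalOn F hg P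
    have := IsUniversalOn.isIso F hg hB hB' (b ≫ v)
    exact ⟨a ≫ v ≫ inv (b ≫ v)⟩
  exact (IsTerminal.ofUniqueHom (fun A => (hlift A).some)
    (fun _ _ => IsUniversalOn.hom_ext F hg hB _ _)).hasTerminal

end Representability

end Brown

end TensorTriangular

namespace TensorTriangular

/-! ### Right adjoints that preserve coproducts -/

section RightAdjoint

variable {C : Type u₁} [Category.{v} C] [Preadditive C] {D : Type u₂} [Category.{v} D]
  [HasZeroObject D] [HasShift D ℤ] [Preadditive D] [∀ n : ℤ, (shiftFunctor D n).Additive]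
  [Pretriangulated D]

/-- The right adjoint of a functor which preserves compact objects preserves coproducts. -/
lemma preservesCoproducts_of_adjunction (hD : IsCompactlyGenerated D) (hC : HasCoproducts.{v} C)
    {F : D ⥤ C} {G : C ⥤ D} (adj : F ⊣ G) [F.Additive]
    (hF : ∀ d : D, IsCompactObject d → IsCompactObject (F.obj d)) (J : Type v) :
    PreservesColimitsOfShape (Discrete J) G := by
  classical
  have := hD.hasCoproducts
  have : G.Additive := adj.right_adjoint_additive
  obtain ⟨I, g, hg⟩ := hD.exists_isCompactGeneratingFamily
  suffices ∀ X : J → C, IsIso (sigmaComparison G X) from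
    have (X : J → C) := PreservesCoproduct.of_iso_comparison G X
    preservesColimitsOfShape_of_discrete G
  refine fun X => hg.isIso _ (fun i => ⟨fun φ φ' h => ?_, fun φ => ?_⟩)
  · have hφ : (φ - φ') ≫ sigmaComparison G X = 0 := by
      rw [Preadditive.sub_comp, sub_eq_zero]
      exact h
    rw [← sub_eq_zero]
    refine eq_zero_of_comp_π_eq_zero (hg.isCompactObject i) _ _ (fun j => ?_)
    have hπ : sigmaComparison G X ≫ G.map (Sigma.π X j) =
        Sigma.π (fun j => G.obj (X j)) j := by
      refine Sigma.hom_ext _ _ (fun k => ?_)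
      rw [ι_comp_sigmaComparison_assoc, ← G.map_comp]
      by_cases hkj : k = j
      · subst hkj
        rw [Sigma.ι_π_eq_id, Sigma.ι_π_eq_id, G.map_id]
      · rw [Sigma.ι_π_of_ne _ hkj, Sigma.ι_π_of_ne _ hkj, G.map_zero]
    rw [← hπ, ← Category.assoc, hφ, zero_comp]
  -- Surjectivity: the transpose of `φ` has compact source, so it is a finite sum, and each term is
  -- transposed back separately.
  · obtain ⟨s, f, hf⟩ := exists_finset_sum_of_isCompactObject (hF _ (hg.isCompactObject i)) X
      ((adj.homEquiv _ _).symm φ)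
    refine ⟨∑ j ∈ s, adj.homEquiv _ _ (f j) ≫ Sigma.ι (fun j => G.obj (X j)) j, ?_⟩
    dsimp only
    rw [Preadditive.sum_comp, ← (adj.homEquiv _ _).apply_symm_apply φ, hf]
    simp only [Category.assoc, ι_comp_sigmaComparison, ← Adjunction.homEquiv_naturality_right]
    exact (map_sum (adj.homAddEquiv _ _) _ s).symm

end RightAdjoint

/-! ### Rigid objects and exact pairings -/

section Rigid

variable {C : Type u} [Category.{v} C] [MonoidalCategory C]

/-- The image of an exact pairing under a strong monoidal functor. -/
@[reducible]
def exactPairingMap {D : Type u₂} [Category.{v} D] [MonoidalCategory D] (F : C ⥤ D) [F.Monoidal]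
    (X Y : C) [ExactPairing X Y] : ExactPairing (F.obj X) (F.obj Y) where
  coevaluation' := Functor.LaxMonoidal.ε F ≫ F.map (η_ X Y) ≫ Functor.OplaxMonoidal.δ F X Y
  evaluation' := Functor.LaxMonoidal.μ F Y X ≫ F.map (ε_ X Y) ≫ Functor.OplaxMonoidal.η F
  coevaluation_evaluation' := by
    have h := F.congr_map (ExactPairing.coevaluation_evaluation X Y)
    simp only [Functor.map_comp, Functor.Monoidal.map_whiskerLeft,
      Functor.Monoidal.map_whiskerRight, Functor.Monoidal.map_associator_inv,
      Functor.Monoidal.map_rightUnitor, Functor.Monoidal.map_leftUnitor_inv, Category.assoc,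
      Functor.Monoidal.μ_δ_assoc, cancel_epi] at h
    simp only [← Category.assoc, cancel_mono] at h
    simp only [Category.assoc] at h
    simp only [MonoidalCategory.whiskerLeft_comp, comp_whiskerRight, Category.assoc,
      reassoc_of% h]
    simp
  evaluation_coevaluation' := by
    have h := F.congr_map (ExactPairing.evaluation_coevaluation X Y)
    simp only [Functor.map_comp, Functor.Monoidal.map_whiskerLeft,
      Functor.Monoidal.map_whiskerRight, Functor.Monoidal.map_associator,
      Functor.Monoidal.map_rightUnitor_inv, Functor.Monoidal.map_leftUnitor, Category.assoc,
      Functor.Monoidal.μ_δ_assoc, cancel_epi] at h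
    simp only [← Category.assoc, cancel_mono] at h
    simp only [Category.assoc] at h
    simp only [MonoidalCategory.whiskerLeft_comp, comp_whiskerRight, Category.assoc,
      reassoc_of% h]
    simp

/-- One triangle identity yields the other after pairing with `e`. When `e` is the evaluation of the
internal hom, a morphism into `y` is determined by this composite, so the second identity comes for
free. -/
lemma whiskerLeft_coevaluation_evaluation_comp {x y : C} (η : 𝟙_ C ⟶ y ⊗ x) (e : x ⊗ y ⟶ 𝟙_ C)
    (h : x ◁ η ≫ (α_ x y x).inv ≫ e ▷ x = (ρ_ x).hom ≫ (λ_ x).inv) :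
    x ◁ ((λ_ y).inv ≫ (η ▷ y ≫ (α_ y x y).hom ≫ y ◁ e) ≫ (ρ_ y).hom) ≫ e = e :=
  calc
    _ = 𝟙 _ ⊗≫ x ◁ η ▷ y ⊗≫ ((x ⊗ y) ◁ e ≫ e ▷ 𝟙_ C) ⊗≫ 𝟙 (𝟙_ C) := by monoidal
    _ = 𝟙 _ ⊗≫ (x ◁ η ≫ (α_ x y x).inv ≫ e ▷ x) ▷ y ⊗≫ e ⊗≫ 𝟙 (𝟙_ C) := by
      rw [whisker_exchange]
      monoidal
    _ = _ := by
      rw [h]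
      monoidal

variable [MonoidalClosed C]

/-- The exact pairing between a rigid object and its dual. -/
@[reducible]
noncomputable def IsRigid.exactPairing {x : C} (hx : IsRigid x) :
    ExactPairing ((ihom x).obj (𝟙_ C)) x :=
  have := hx x
  have h : x ◁ (MonoidalClosed.curry (ρ_ x).hom ≫ inv (rigidityMap x x)) ≫
      (α_ x ((ihom x).obj (𝟙_ C)) x).inv ≫ (ihom.ev x).app (𝟙_ C) ▷ x = (ρ_ x).hom ≫ (λ_ x).inv := by
    rw [← cancel_mono (λ_ x).hom]
    apply MonoidalClosed.curry_injective
    simp only [Category.assoc, Iso.inv_hom_id, Category.comp_id]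
    rw [MonoidalClosed.curry_natural_left, Category.assoc]
    change _ ≫ inv (rigidityMap x x) ≫ rigidityMap x x = _
    rw [IsIso.inv_hom_id, Category.comp_id]
  { coevaluation' := MonoidalClosed.curry (ρ_ x).hom ≫ inv (rigidityMap x x)
    evaluation' := (ihom.ev x).app (𝟙_ C)
    coevaluation_evaluation' := h
    evaluation_coevaluation' := by
      rw [← cancel_mono (ρ_ _).hom, ← cancel_epi (λ_ _).inv]
      apply MonoidalClosed.uncurry_injective
      rw [MonoidalClosed.uncurry_eq, MonoidalClosed.uncurry_eq]
      generalize MonoidalClosed.curry (ρ_ x).hom ≫ inv (rigidityMap x x) = η at h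
      rw [Category.assoc (λ_ _).hom, Iso.inv_hom_id_assoc, Iso.inv_hom_id, MonoidalCategory.whiskerLeft_id, Category.id_comp]
      exact whiskerLeft_coevaluation_evaluation_comp η _ h }

/-- Both `x' ⊗ -` and `[x, -]` are right adjoint to `x ⊗ -`, so the comparison `t` is invertible. At
`y = 𝟙_ C` it identifies `x'` with `[x, 𝟙_ C]`, and under this identification `t` is `rigidityMap
x`. -/
lemma isRigid_of_exactPairing (x' x : C) [ExactPairing x' x] : IsRigid x := by
  let t (y : C) : x' ⊗ y ⟶ (ihom x).obj y :=
    MonoidalClosed.curry ((α_ x x' y).inv ≫ ε_ x' x ▷ y ≫ (λ_ y).hom)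
  have ht (y : C) : IsIso (t y) := by
    refine isIso_of_yoneda_map_bijective _ (fun z => ?_)
    have : (fun k : z ⟶ x' ⊗ y => k ≫ t y) =
        ((tensorLeftHomEquiv z x' x y).symm.trans ((ihom.adjunction x).homEquiv z y)) := by
      ext k
      change _ = MonoidalClosed.curry (x ◁ k ≫ _)
      rw [MonoidalClosed.curry_natural_left]
    rw [this]
    exact Equiv.bijective _
  have h₁ : IsIso (MonoidalClosed.curry (ε_ x' x)) := by
    have : t (𝟙_ C) = (ρ_ x').hom ≫ MonoidalClosed.curry (ε_ x' x) := by
      rw [← MonoidalClosed.curry_natural_left]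
      change MonoidalClosed.curry _ = _
      congr 1
      simp [unitors_equal]
    have h := ht (𝟙_ C)
    rw [this] at h
    exact IsIso.of_isIso_comp_left (ρ_ x').hom _
  intro y
  have : t y = MonoidalClosed.curry (ε_ x' x) ▷ y ≫ rigidityMap x y := by
    dsimp only [rigidityMap]
    rw [← MonoidalClosed.curry_natural_left, MonoidalCategory.associator_inv_naturality_middle_assoc, ← comp_whiskerRight_assoc,
      MonoidalClosed.whiskerLeft_curry_ihom_ev_app]
  have h := ht y
  rw [this] at h
  exact IsIso.of_isIso_comp_left (MonoidalClosed.curry (ε_ x' x) ▷ y) _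

lemma IsRigid.dual [SymmetricCategory C] {x : C} (hx : IsRigid x) : IsRigid ((ihom x).obj (𝟙_ C)) :=
  letI := hx.exactPairing
  letI := BraidedCategory.exactPairing_swap ((ihom x).obj (𝟙_ C)) x
  isRigid_of_exactPairing x _

lemma IsRigid.map_of_monoidal {D : Type u₂} [Category.{v} D] [MonoidalCategory D]
    [MonoidalClosed D] (F : C ⥤ D) [F.Monoidal] {x : C} (hx : IsRigid x) : IsRigid (F.obj x) :=
  letI := hx.exactPairing
  letI := exactPairingMap F ((ihom x).obj (𝟙_ C)) x
  isRigid_of_exactPairing (F.obj ((ihom x).obj (𝟙_ C))) _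

end Rigid

end TensorTriangular

namespace TensorTriangular

/-! ### Perfect pairings and reflexivity -/

section Pairings

lemma bijective_precomp_of_isIso {C : Type u} [Category.{v} C] {κ a b : C} (e : a ⟶ b) [IsIso e] :
    Function.Bijective (fun f : b ⟶ κ => e ≫ f) :=
  ⟨fun _ _ h => (cancel_epi e).1 h, fun f => ⟨inv e ≫ f, by simp⟩⟩

variable {C : Type u} [Category.{v} C] [MonoidalCategory C] {κ : C}

/-- A pairing `p : x ⊗ w ⟶ κ` is right perfect at `z` if it induces a bijection
`Hom(z, w) ≃ Hom(x ⊗ z, κ)`. -/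
def RightPerfectAt {x w : C} (p : x ⊗ w ⟶ κ) (z : C) : Prop :=
  Function.Bijective (fun f : z ⟶ w => x ◁ f ≫ p)

/-- A pairing `p : x ⊗ w ⟶ κ` is left perfect at `z` if it induces a bijection
`Hom(z, x) ≃ Hom(z ⊗ w, κ)`. -/
def LeftPerfectAt {x w : C} (p : x ⊗ w ⟶ κ) (z : C) : Prop :=
  Function.Bijective (fun f : z ⟶ x => f ▷ w ≫ p)

lemma RightPerfectAt.of_iso {x w z z' : C} {p : x ⊗ w ⟶ κ} (h : RightPerfectAt p z) (e : z ≅ z') :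
    RightPerfectAt p z' := by
  rw [RightPerfectAt]
  have := (bijective_precomp_of_isIso (κ := κ) (x ◁ e.inv)).comp
    (h.comp (bijective_precomp_of_isIso (κ := w) e.hom))
  convert this using 2 with f
  simp

lemma LeftPerfectAt.of_iso {x w z z' : C} {p : x ⊗ w ⟶ κ} (h : LeftPerfectAt p z) (e : z ≅ z') :
    LeftPerfectAt p z' := by
  rw [LeftPerfectAt]
  have := (bijective_precomp_of_isIso (κ := κ) (e.inv ▷ w)).comp
    (h.comp (bijective_precomp_of_isIso (κ := x) e.hom))
  convert this using 2 with f
  simp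

section Closed

variable [MonoidalClosed C]

lemma bijective_comp_curry_iff {x w : C} (p : x ⊗ w ⟶ κ) (z : C) :
    Function.Bijective (fun f : z ⟶ w => f ≫ MonoidalClosed.curry p) ↔ RightPerfectAt p z := by
  rw [RightPerfectAt,
    ← Function.Bijective.of_comp_iff' ((ihom.adjunction x).homEquiv z κ).bijective]
  refine iff_of_eq (congr_arg _ (funext fun f => ?_))
  exact (MonoidalClosed.curry_natural_left f p).symm

lemma isIso_curry_iff {x w : C} (p : x ⊗ w ⟶ κ) :
    IsIso (MonoidalClosed.curry p) ↔ ∀ z, RightPerfectAt p z := by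
  simp only [← bijective_comp_curry_iff]
  exact ⟨fun _ z => ⟨fun _ _ h => (cancel_mono _).1 h,
    fun f => ⟨f ≫ inv (MonoidalClosed.curry p), by simp⟩⟩,
    fun h => isIso_of_yoneda_map_bijective _ h⟩

variable (κ) in
/-- The evaluation pairing `x ⊗ [x, κ] ⟶ κ`. -/
def evaluationPairing (x : C) : x ⊗ (ihom x).obj κ ⟶ κ := (ihom.ev x).app κ

lemma rightPerfectAt_evaluationPairing (x z : C) : RightPerfectAt (evaluationPairing κ x) z := by
  refine (isIso_curry_iff _).1 ?_ z
  have : MonoidalClosed.curry (evaluationPairing κ x) = 𝟙 _ := by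
    rw [MonoidalClosed.curry_eq_iff]
    exact (MonoidalClosed.uncurry_id_eq_ev _ _).symm
  rw [this]
  infer_instance

end Closed

variable [SymmetricCategory C]

lemma rightPerfectAt_braiding_iff {x w : C} (p : x ⊗ w ⟶ κ) (z : C) :
    RightPerfectAt ((β_ w x).hom ≫ p) z ↔ LeftPerfectAt p z := by
  rw [LeftPerfectAt, ← Function.Bijective.of_comp_iff'
    (bijective_precomp_of_isIso (κ := κ) (β_ w z).hom)]
  refine iff_of_eq (congr_arg _ (funext fun f => ?_))
  simp

variable [MonoidalClosed C]

/-- An object `x` is `κ`-reflexive as soon as one right perfect pairing `x ⊗ w ⟶ κ` is left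
perfect. -/
lemma isReflexive_iff_leftPerfectAt {x w : C} (p : x ⊗ w ⟶ κ) (hp : ∀ z, RightPerfectAt p z) :
    IsReflexive κ x ↔ ∀ z, LeftPerfectAt p z := by
  have := (isIso_curry_iff p).2 hp
  have h : IsReflexive κ x ↔
      IsIso (MonoidalClosed.curry ((β_ ((ihom x).obj κ) x).hom ≫ evaluationPairing κ x)) := by
    rw [IsReflexive, biduality_eq]
    rfl
  rw [h, isIso_curry_iff]
  refine forall_congr' (fun z => ?_)
  -- The isomorphism `w ≅ [x, κ]` given by `p` carries the evaluation pairing to `p`.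
  rw [rightPerfectAt_braiding_iff, LeftPerfectAt, ← Function.Bijective.of_comp_iff'
    (bijective_precomp_of_isIso (κ := κ) (z ◁ MonoidalClosed.curry p))]
  refine iff_of_eq (congr_arg _ (funext fun f => ?_))
  change z ◁ _ ≫ f ▷ _ ≫ _ = f ▷ w ≫ p
  rw [whisker_exchange_assoc]
  have h := MonoidalClosed.whiskerLeft_curry_ihom_ev_app _ _ p
  exact congr_arg (fun q => f ▷ w ≫ q) h

lemma IsReflexive.of_iso {x y : C} (hx : IsReflexive κ x) (e : x ≅ y) : IsReflexive κ y := by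
  let p := e.inv ▷ _ ≫ evaluationPairing κ x
  have hx' := (isReflexive_iff_leftPerfectAt _ (fun z => rightPerfectAt_evaluationPairing (κ := κ) x z)).1 hx
  refine (isReflexive_iff_leftPerfectAt p (fun z => ?_)).2 (fun z => ?_)
  · rw [RightPerfectAt]
    have := (bijective_precomp_of_isIso (κ := κ) (e.inv ▷ z)).comp (rightPerfectAt_evaluationPairing (κ := κ) x z)
    convert this using 2 with f
    simp [p, whisker_exchange_assoc]
  · rw [LeftPerfectAt]
    have := (hx' z).comp (⟨fun _ _ h => (cancel_mono e.inv).1 h, fun f => ⟨f ≫ e.hom, by simp⟩⟩ :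
      Function.Bijective (fun f : z ⟶ y => f ≫ e.inv))
    convert this using 2 with f
    simp [p]

end Pairings

/-! ### Twisting a pairing by a dual pair -/

section TensorPairing

variable {C : Type u} [Category.{v} C] [MonoidalCategory C] {κ : C} (c' c : C) [ExactPairing c' c]

/-- The pairing `(x ⊗ c) ⊗ (c' ⊗ w) ⟶ x ⊗ w ⟶ κ` obtained from a pairing `x ⊗ w ⟶ κ` and a pair
of dual objects. -/
def tensorPairing {x w : C} (p : x ⊗ w ⟶ κ) : (x ⊗ c) ⊗ (c' ⊗ w) ⟶ κ :=
  (α_ x c (c' ⊗ w)).hom ≫ x ◁ (tensorLeftHomEquiv (c' ⊗ w) c' c w).symm (𝟙 _) ≫ p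

lemma rightPerfectAt_tensorPairing {x w : C} (p : x ⊗ w ⟶ κ) {z : C}
    (h : RightPerfectAt p (c ⊗ z)) : RightPerfectAt (tensorPairing c' c p) z := by
  rw [RightPerfectAt]
  have := (bijective_precomp_of_isIso (κ := κ) (α_ x c z).hom).comp
    (h.comp (tensorLeftHomEquiv z c' c w).symm.bijective)
  convert this using 2 with f
  dsimp only [Function.comp_apply]
  have hf := tensorLeftHomEquiv_symm_naturality (Y := c') (Y' := c) f (𝟙 (c' ⊗ w))
  rw [Category.comp_id] at hf
  simp [tensorPairing, hf]

/-- Duality gives `Hom(z, x ⊗ c) ≃ Hom(z ⊗ c', x)`: twisting the pairing shifts the test object. -/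
lemma leftPerfectAt_tensorPairing_iff {x w : C} (p : x ⊗ w ⟶ κ) (z : C) :
    LeftPerfectAt (tensorPairing c' c p) z ↔ LeftPerfectAt p (z ⊗ c') := by
  rw [LeftPerfectAt, LeftPerfectAt, ← Function.Bijective.of_comp_iff _
    (tensorRightHomEquiv z c' c x).symm.bijective, ← Function.Bijective.of_comp_iff'
    (bijective_precomp_of_isIso (κ := κ) (α_ z c' w).inv)]
  refine iff_of_eq (congr_arg _ (funext fun f => ?_))
  have : tensorPairing c' c p = (α_ (x ⊗ c) c' w).inv ≫ (α_ x c c').hom ▷ w ≫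
      (x ◁ ε_ c' c) ▷ w ≫ (ρ_ x).hom ▷ w ≫ p := by
    dsimp [tensorPairing, tensorLeftHomEquiv]
    monoidal
  simp [this, tensorRightHomEquiv]

end TensorPairing

/-! ### Projection formula and push-forward of pairings -/

section PushForward

variable {C : Type u₁} [Category.{v} C] [MonoidalCategory C]
  {D : Type u₂} [Category.{v} D] [MonoidalCategory D]
  {F : D ⥤ C} [F.Monoidal] {G : C ⥤ D} {H : D ⥤ C} (adj₁ : F ⊣ G) (adj₂ : G ⊣ H)

/-- The projection morphism `G x ⊗ d ⟶ G (x ⊗ F d)`. -/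
def projectionMap (x : C) (d : D) : G.obj x ⊗ d ⟶ G.obj (x ⊗ F.obj d) :=
  adj₁.homEquiv _ _ (Functor.OplaxMonoidal.δ F (G.obj x) d ≫ adj₁.counit.app x ▷ F.obj d)

/-- The projection formula for dualizable objects. -/
lemma isIso_projectionMap (x : C) (d' d : D) [ExactPairing d' d] :
    IsIso (projectionMap adj₁ x d) := by
  let := exactPairingMap F d' d
  refine isIso_of_yoneda_map_bijective _ (fun e => ?_)
  have hμ : IsIso (Functor.LaxMonoidal.μ F e d') := inferInstance
  -- The chain is `Hom(e, G x ⊗ d) ≃ Hom(e ⊗ d', G x) ≃ Hom(F (e ⊗ d'), x) ≃ Hom(F e ⊗ F d', x) ≃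
  -- Hom(F e, x ⊗ F d) ≃ Hom(e, G (x ⊗ F d))`; what remains is that it is composition with
  -- `projectionMap`.
  have := (adj₁.homEquiv e (x ⊗ F.obj d)).bijective.comp
    ((tensorRightHomEquiv (F.obj e) (F.obj d') (F.obj d) x).bijective.comp
      ((bijective_precomp_of_isIso (κ := x) (Functor.LaxMonoidal.μ F e d')).comp
        ((adj₁.homEquiv (e ⊗ d') x).symm.bijective.comp
          (tensorRightHomEquiv e d' d (G.obj x)).symm.bijective)))
  convert this using 2 with f
  obtain ⟨k, rfl⟩ := (tensorRightHomEquiv e d' d (G.obj x)).surjective f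
  apply (adj₁.homEquiv _ _).symm.injective
  rw [Adjunction.homEquiv_naturality_left_symm, projectionMap]
  have hη : η_ (F.obj d') (F.obj d) = Functor.LaxMonoidal.ε F ≫ F.map (η_ d' d) ≫
    Functor.OplaxMonoidal.δ F d' d := rfl
  dsimp only [Function.comp_apply]
  rw [Equiv.symm_apply_apply, Equiv.symm_apply_apply, Equiv.symm_apply_apply,
    Adjunction.homEquiv_counit]
  simp only [tensorRightHomEquiv, Equiv.coe_fn_mk, hη, Functor.map_comp,
    Functor.Monoidal.map_whiskerLeft, Functor.Monoidal.map_whiskerRight,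
    Functor.Monoidal.map_associator_inv, Functor.Monoidal.map_rightUnitor_inv, Category.assoc,
    comp_whiskerRight, MonoidalCategory.whiskerLeft_comp, Functor.Monoidal.μ_δ_assoc]

/-- The pairing `G x ⊗ G w ⟶ κ` obtained by applying `G` to a pairing `x ⊗ w ⟶ H κ`. -/
def pushPairing {x w : C} {κ : D} (p : x ⊗ w ⟶ H.obj κ) : G.obj x ⊗ G.obj w ⟶ κ :=
  adj₁.homEquiv _ _ (Functor.OplaxMonoidal.δ F (G.obj x) (G.obj w) ≫
    (adj₁.counit.app x ⊗ₘ adj₁.counit.app w) ≫ p) ≫ adj₂.counit.app κ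

/-- The two sides match under `Hom(d, G w) ≃ Hom(F d, w)` and, by the projection formula, `Hom(G x ⊗
d, κ) ≃ Hom(G (x ⊗ F d), κ) ≃ Hom(x ⊗ F d, H κ)`. -/
lemma rightPerfectAt_pushPairing_iff {x w : C} {κ : D} (p : x ⊗ w ⟶ H.obj κ) (d' d : D)
    [ExactPairing d' d] :
    RightPerfectAt (pushPairing adj₁ adj₂ p) d ↔ RightPerfectAt p (F.obj d) := by
  have := isIso_projectionMap adj₁ x d' d
  rw [RightPerfectAt, RightPerfectAt, ← Function.Bijective.of_comp_iff _
    (adj₁.homEquiv d w).bijective, ← Function.Bijective.of_comp_iff'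
    (adj₂.homEquiv (x ⊗ F.obj d) κ).symm.bijective, ← Function.Bijective.of_comp_iff'
    (bijective_precomp_of_isIso (κ := κ) (projectionMap adj₁ x d))]
  refine iff_of_eq (congr_arg _ (funext fun f => ?_))
  dsimp only [Function.comp_apply, pushPairing]
  rw [Adjunction.homEquiv_counit]
  refine (Category.assoc _ _ _).symm.trans (Eq.trans
    (congr_arg (fun q => q ≫ adj₂.counit.app κ) ?_) (Category.assoc _ _ _))
  rw [← Adjunction.homEquiv_naturality_left, projectionMap, ← Adjunction.homEquiv_naturality_right]
  congr 1
  have hf : F.map (adj₁.homEquiv d w f) ≫ adj₁.counit.app w = f :=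
    (adj₁.homEquiv_counit _ _ _).symm.trans ((adj₁.homEquiv d w).symm_apply_apply f)
  simp only [Category.assoc, ← Functor.OplaxMonoidal.δ_natural_right_assoc,
    MonoidalCategory.tensorHom_def]
  rw [whisker_exchange_assoc, ← MonoidalCategory.whiskerLeft_comp_assoc, hf]
  rfl

lemma braiding_pushPairing [SymmetricCategory C] [SymmetricCategory D] (F : D ⥤ C) [F.Braided]
    (adj₁ : F ⊣ G) {x w : C} {κ : D} (p : x ⊗ w ⟶ H.obj κ) :
    (β_ (G.obj w) (G.obj x)).hom ≫ pushPairing adj₁ adj₂ p =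
      pushPairing adj₁ adj₂ ((β_ w x).hom ≫ p) := by
  rw [pushPairing, pushPairing, ← Category.assoc, ← Adjunction.homEquiv_naturality_left]
  refine congr_arg (fun q => adj₁.homEquiv _ _ q ≫ adj₂.counit.app κ) ?_
  simp

end PushForward

/-! ### Objects with a dualizing object are reflexive -/

section Dualizing

variable {C : Type u} [Category.{v} C] [MonoidalCategory C] [SymmetricCategory C]
  [MonoidalClosed C]

/-- Translates full faithfulness of `Δ_κ` into bijectivity of composition with the biduality
morphism. -/
lemma selfAdjunctionEquiv_map {κ x y : C} (f : x ⟶ y) :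
    selfAdjunctionEquiv κ ((twistedDual κ).obj (op y)) x ((twistedDual κ).map f.op) =
      f ≫ biduality κ y := by
  have h : ((ihom.adjunction x).homEquiv ((ihom y).obj κ) κ).symm
      ((MonoidalClosed.pre f).app κ) = f ▷ _ ≫ (ihom.ev y).app κ := MonoidalClosed.uncurry_pre f κ
  rw [biduality_eq]
  refine Eq.trans ?_ (MonoidalClosed.curry_natural_left f _)
  change (ihom.adjunction ((ihom y).obj κ)).homEquiv x κ
    ((β_ x ((ihom y).obj κ)).inv ≫ ((ihom.adjunction x).homEquiv ((ihom y).obj κ) κ).symm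
      ((MonoidalClosed.pre f).app κ) ≫ 𝟙 κ) = _
  rw [h, Category.comp_id, ← SymmetricCategory.braiding_swap_eq_inv_braiding]
  have h' : (β_ ((ihom y).obj κ) x).hom ≫ f ▷ _ ≫ (ihom.ev y).app κ =
      (ihom y).obj κ ◁ f ≫ (β_ ((ihom y).obj κ) y).hom ≫ (ihom.ev y).app κ := by
    rw [BraidedCategory.braiding_naturality_right_assoc]
  exact congr_arg MonoidalClosed.curry h'

lemma IsDualizing.isReflexive {P : ObjectProperty C} {κ : C} (h : IsDualizing P κ) {x : C}
    (hx : P x) : IsReflexive κ x := by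
  have := h.isEquivalence
  let Φ := P.lift (P.ι.op ⋙ twistedDual κ) (fun x => h.dual_mem x.unop.obj x.unop.property)
  have hΦ {y z : C} (hy : P y) (hz : P z) :
      Function.Bijective (fun f : y ⟶ z => f ≫ biduality κ z) := by
    let Ψ := P.ι.op ⋙ twistedDual κ
    have e : Φ ⋙ P.ι ≅ Ψ := P.liftCompιIso _ _
    have : Ψ.Full := Functor.Full.of_iso e
    have : Ψ.Faithful := Functor.Faithful.of_iso e
    have hΨ := (selfAdjunctionEquiv κ ((twistedDual κ).obj (op z)) y).bijective.comp
      (((Functor.FullyFaithful.ofFullyFaithful Ψ).homEquiv (X := op ⟨z, hz⟩)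
        (Y := op ⟨y, hy⟩)).bijective.comp (Quiver.Hom.opEquiv.bijective.comp
          (P.fullyFaithfulι.homEquiv (X := ⟨y, hy⟩) (Y := ⟨z, hz⟩)).symm.bijective))
    exact (congr_arg Function.Bijective (funext fun f => selfAdjunctionEquiv_map f)).mp hΨ
  -- As `Δ_κ Δ_κ x` lies in `P`, it is an admissible test object, and lifting its identity inverts
  -- `biduality κ x`.
  have hΔ := h.dual_mem _ (h.dual_mem x hx)
  obtain ⟨s, hs⟩ := (hΦ hΔ hx).2 (𝟙 _)
  refine ⟨s, (hΦ hx hx).1 ?_, hs⟩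
  dsimp only at hs ⊢
  rw [Category.assoc, hs, Category.comp_id, Category.id_comp]

end Dualizing

end TensorTriangular

namespace TensorTriangular

/-! ### Transfer of reflexivity along the adjunctions -/

section MainTheorem

lemma isCompactObject_obj_of_monoidal {C : Type u₁} [Category.{v} C] [Preadditive C]
    [MonoidalCategory C] [SymmetricCategory C] [MonoidalClosed C] {D : Type u₂} [Category.{v} D]
    [Preadditive D] [MonoidalCategory D] [SymmetricCategory D] [MonoidalClosed D]
    (hC : IsRigidlyCompactlyGenerated C)
    (hD : IsRigidlyCompactlyGenerated D) (F : D ⥤ C) [F.Monoidal] (d : D)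
    (hd : IsCompactObject d) : IsCompactObject (F.obj d) :=
  (hC.compact_iff_rigid _).2 (((hD.compact_iff_rigid d).1 hd).map_of_monoidal F)

variable {C : Type u₁} [Category.{v} C] [HasZeroObject C] [HasShift C ℤ] [Preadditive C]
  [∀ n : ℤ, (shiftFunctor C n).Additive] [Pretriangulated C]
  [MonoidalCategory C] [SymmetricCategory C] [MonoidalClosed C]

/-- Perfectness at `z` is bijectivity of composition with `curry p` on `Hom(z, -)`, and generators
detect isomorphisms. -/
lemma IsRigidlyCompactlyGenerated.rightPerfectAt
    (hC : IsRigidlyCompactlyGenerated C) {κ x w : C} (p : x ⊗ w ⟶ κ)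
    (h : ∀ c, IsCompactObject c → RightPerfectAt p c) (z : C) : RightPerfectAt p z := by
  obtain ⟨I, g, hg⟩ := hC.toIsCompactlyGenerated.exists_isCompactGeneratingFamily
  refine (isIso_curry_iff p).1 (hg.isIso _ (fun i => ?_)) z
  rw [bijective_comp_curry_iff]
  exact h _ (hg.isCompactObject i)

variable {D : Type u₂} [Category.{v} D] [HasZeroObject D] [HasShift D ℤ] [Preadditive D]
  [∀ n : ℤ, (shiftFunctor D n).Additive] [Pretriangulated D]
  [MonoidalCategory D] [SymmetricCategory D] [MonoidalClosed D]
  {F : D ⥤ C} {G : C ⥤ D} {H : D ⥤ C}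

omit [HasZeroObject C] [HasShift C ℤ] [Preadditive C] [∀ n : ℤ, (shiftFunctor C n).Additive]
  [Pretriangulated C] [SymmetricCategory C] [MonoidalClosed C] in
lemma rightPerfectAt_pushPairing (hD : IsRigidlyCompactlyGenerated D) [F.Monoidal] (adj₁ : F ⊣ G)
    (adj₂ : G ⊣ H) {x w : C} {κ : D} (p : x ⊗ w ⟶ H.obj κ) (hp : ∀ z, RightPerfectAt p z) (d : D) :
    RightPerfectAt (pushPairing adj₁ adj₂ p) d := by
  refine hD.rightPerfectAt _ (fun c hc => ?_) d
  let := ((hD.compact_iff_rigid c).1 hc).exactPairing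
  exact (rightPerfectAt_pushPairing_iff adj₁ adj₂ p ((ihom c).obj (𝟙_ D)) c).2 (hp _)

omit [HasZeroObject C] [HasShift C ℤ] [Preadditive C] [∀ n : ℤ, (shiftFunctor C n).Additive]
  [Pretriangulated C] [MonoidalClosed C] in
lemma leftPerfectAt_pushPairing (hD : IsRigidlyCompactlyGenerated D) [F.Braided] (adj₁ : F ⊣ G)
    (adj₂ : G ⊣ H) {x w : C} {κ : D} (p : x ⊗ w ⟶ H.obj κ) (hp : ∀ z, LeftPerfectAt p z) (d : D) :
    LeftPerfectAt (pushPairing adj₁ adj₂ p) d := by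
  rw [← rightPerfectAt_braiding_iff, braiding_pushPairing]
  exact rightPerfectAt_pushPairing hD adj₁ adj₂ _
    (fun z => (rightPerfectAt_braiding_iff p z).2 (hp z)) d

lemma isReflexive_of_compactPullback (hC : IsRigidlyCompactlyGenerated C)
    (hD : IsRigidlyCompactlyGenerated D) [F.Braided] (adj₁ : F ⊣ G) (adj₂ : G ⊣ H) {κ : D} {x : C}
    (hx : ∀ c, IsCompactObject c → IsReflexive κ (G.obj (c ⊗ x))) :
    IsReflexive (H.obj κ) x := by
  let p := evaluationPairing (H.obj κ) x
  have hp (z : C) : RightPerfectAt p z := rightPerfectAt_evaluationPairing x z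
  rw [isReflexive_iff_leftPerfectAt p hp]
  simp only [← rightPerfectAt_braiding_iff]
  refine hC.rightPerfectAt _ (fun c' hc' => ?_)
  have hrig := (hC.compact_iff_rigid c').1 hc'
  let c := (ihom c').obj (𝟙_ C)
  let := hrig.exactPairing
  let := BraidedCategory.exactPairing_swap c c'
  have hc : IsCompactObject c := (hC.compact_iff_rigid c).2 hrig.dual
  let q := tensorPairing c' c p
  have hq (z : C) : RightPerfectAt q z := rightPerfectAt_tensorPairing c' c p (hp _)
  have hrefl : IsReflexive κ (G.obj (x ⊗ c)) := (hx c hc).of_iso (G.mapIso (β_ c x))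
  -- Testing at `𝟙_ D` is enough: it gives left perfectness of `q` at `F.obj (𝟙_ D) ≅ 𝟙_ C`, hence
  -- of `p` at `𝟙_ C ⊗ c' ≅ c'`.
  have h₁ := (isReflexive_iff_leftPerfectAt _ (rightPerfectAt_pushPairing hD adj₁ adj₂ q hq)).1
    hrefl (𝟙_ D)
  rw [← rightPerfectAt_braiding_iff, braiding_pushPairing,
    rightPerfectAt_pushPairing_iff adj₁ adj₂ _ (𝟙_ D) (𝟙_ D), rightPerfectAt_braiding_iff,
    leftPerfectAt_tensorPairing_iff] at h₁
  rw [rightPerfectAt_braiding_iff]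
  exact h₁.of_iso ((Functor.Monoidal.εIso F).symm ▷ᵢ c' ≪≫ λ_ c')

lemma isReflexive_obj_tensor (hC : IsRigidlyCompactlyGenerated C)
    (hD : IsRigidlyCompactlyGenerated D) [F.Braided] (adj₁ : F ⊣ G) (adj₂ : G ⊣ H) {κ : D} {x : C}
    (hx : IsReflexive (H.obj κ) x) (c : C) (hc : IsCompactObject c) :
    IsReflexive κ (G.obj (c ⊗ x)) := by
  let p := evaluationPairing (H.obj κ) x
  have hp (z : C) : RightPerfectAt p z := rightPerfectAt_evaluationPairing x z
  let c' := (ihom c).obj (𝟙_ C)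
  let := ((hC.compact_iff_rigid c).1 hc).exactPairing
  let q := tensorPairing c' c p
  have hq (z : C) : RightPerfectAt q z := rightPerfectAt_tensorPairing c' c p (hp _)
  have hq' (z : C) : LeftPerfectAt q z := (leftPerfectAt_tensorPairing_iff c' c p z).2
    ((isReflexive_iff_leftPerfectAt p hp).1 hx _)
  have : IsReflexive κ (G.obj (x ⊗ c)) := (isReflexive_iff_leftPerfectAt _
    (rightPerfectAt_pushPairing hD adj₁ adj₂ q hq)).2 (leftPerfectAt_pushPairing hD adj₁ adj₂ q hq')
  exact this.of_iso (G.mapIso (β_ x c))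

end MainTheorem

end TensorTriangular

theorem mainTheorem7
    {C : Type u₁} [Category.{v} C] [HasZeroObject C] [HasShift C ℤ] [Preadditive C]
    [∀ n : ℤ, (shiftFunctor C n).Additive] [Pretriangulated C] [IsTriangulated C]
    [MonoidalCategory C] [SymmetricCategory C] [MonoidalClosed C]
    [(curriedTensor C).CommShift₂Int] [IsTensorTriangulated C]
    {D : Type u₂} [Category.{v} D] [HasZeroObject D] [HasShift D ℤ] [Preadditive D]
    [∀ n : ℤ, (shiftFunctor D n).Additive] [Pretriangulated D] [IsTriangulated D]
    [MonoidalCategory D] [SymmetricCategory D] [MonoidalClosed D]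
    [(curriedTensor D).CommShift₂Int] [IsTensorTriangulated D]
    (hC : IsRigidlyCompactlyGenerated C) (hD : IsRigidlyCompactlyGenerated D)
    -- a coproduct-preserving tensor-exact functor
    (fPull : D ⥤ C) [fPull.Braided] [fPull.CommShift ℤ] [fPull.IsTriangulated]
    (hf : ∀ J : Type v, PreservesColimitsOfShape (Discrete J) fPull) :
    -- the two adjoints to the right of it exist
    (∃ (fPush : C ⥤ D) (fShriek : D ⥤ C),
      Nonempty (fPull ⊣ fPush) ∧ Nonempty (fPush ⊣ fShriek)) ∧
    -- and, whichever right adjoints are chosen, the two implications hold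
    ∀ (fPush : C ⥤ D) (fShriek : D ⥤ C) (_ : fPull ⊣ fPush) (_ : fPush ⊣ fShriek)
      (D₀ : ObjectProperty D) (_ : IsCompactSubmodule D₀) (κ : D) (_ : IsDualizing D₀ κ),
      (D₀ (𝟙_ D) →
        ∀ x : C, compactPullback fPush D₀ x → IsReflexive (fShriek.obj κ) x) ∧
      ((∀ d : D, D₀ d ↔ IsReflexive κ d) →
        ∀ x : C, IsReflexive (fShriek.obj κ) x → compactPullback fPush D₀ x) := by
  refine ⟨?_, fun G H adj₁ adj₂ D₀ hD₀ κ hκ => ⟨fun _ x hx => ?_, fun hrefl x hx c hc => ?_⟩⟩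
  · have := hD.toIsCompactlyGenerated.isLeftAdjoint fPull hf
    let adj₁ := Adjunction.ofIsLeftAdjoint fPull
    let G := fPull.rightAdjoint
    -- The right adjoint inherits a triangulated structure, so representability applies to it in
    -- turn.
    let := adj₁.rightAdjointCommShift ℤ
    have := adj₁.commShift_of_leftAdjoint ℤ
    have : G.IsTriangulated := adj₁.isTriangulated_rightAdjoint
    have := hC.toIsCompactlyGenerated.isLeftAdjoint G
      (preservesCoproducts_of_adjunction hD.toIsCompactlyGenerated hC.hasCoproducts adj₁
        (isCompactObject_obj_of_monoidal hC hD fPull))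
    exact ⟨G, G.rightAdjoint, ⟨adj₁⟩, ⟨Adjunction.ofIsLeftAdjoint G⟩⟩
  · exact isReflexive_of_compactPullback hC hD adj₁ adj₂ (fun c hc => hκ.isReflexive (hx c hc))
  · exact (hrefl _).2 (isReflexive_obj_tensor hC hD adj₁ adj₂ hx c hc)
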